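/- An \emph{integer rectangle} is a set $[x_1,x_2]\times[y_1,y_2]\subset\mathbb{R}^2$ with $x_1<x_2$ and $y_1<y_2$ integers. Let $S$ be a family of integer rectangles with pairwise disjoint interiors (shared boundary points are allowed). Two rectangles $A,B\in S$ \emph{see each other} if there is a horizontal or vertical line segment that meets the interiors of both $A$ and $B$ and meets no other (closed) rectangle of $S$. The family $S$ is an \emph{integer rectangle visibility representation} of a graph $G$ if its rectangles are in bijection with the vertices of $G$ in such a way that two distinct vertices are adjacent if and only if their rectangles see each other. The \emph{bounding box} of $S$ is the smallest rectangle with horizontal and vertical sides that contains all the rectangles of $S$. The numbers $\operatorname{height}(G)$, $\operatorname{width}(G)$, $\operatorname{area}(G)$ and $\operatorname{perimeter}(G)$ are the minimum height, width, area and perimeter, respectively, of the bounding box, each taken separately over all integer rectangle visibility representations of $G$ whose bounding box has height less than or equal to its width. \textbf{Theorem.} The complete graph $K_8$ has an integer rectangle visibility representation, and $$\operatorname{height}(K_8)=10,\qquad \operatorname{width}(K_8)=10,\qquad \operatorname{area}(K_8)=100,\qquad \operatorname{perimeter}(K_8)=40.$$ -/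

import Mathlib

/-- An integer rectangle with horizontal and vertical sides: its corners are integer lattice points
and it has positive width and height. -/
structure IntRect where
  x₁ : ℤ
  x₂ : ℤ
  y₁ : ℤ
  y₂ : ℤ
  hx : x₁ < x₂
  hy : y₁ < y₂

namespace IntRect

/-- The closed rectangle `[x₁, x₂] × [y₁, y₂]` in the plane. -/
def toSet (A : IntRect) : Set (ℝ × ℝ) :=
  Set.Icc (A.x₁ : ℝ) (A.x₂ : ℝ) ×ˢ Set.Icc (A.y₁ : ℝ) (A.y₂ : ℝ)

def width (A : IntRect) : ℤ := A.x₂ - A.x₁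

def height (A : IntRect) : ℤ := A.y₂ - A.y₁

def area (A : IntRect) : ℤ := A.width * A.height

def perimeter (A : IntRect) : ℤ := 2 * (A.width + A.height)

end IntRect

/-- In the family `R` of rectangles, `R u` and `R v` see each other: there is a vertical or
horizontal line segment that meets the interiors of `R u` and of `R v` and is disjoint from every
other closed rectangle of the family. -/
def Sees {V : Type*} (R : V → IntRect) (u v : V) : Prop :=
  ∃ p q : ℝ × ℝ, (p.1 = q.1 ∨ p.2 = q.2) ∧
    (segment ℝ p q ∩ interior (R u).toSet).Nonempty ∧
    (segment ℝ p q ∩ interior (R v).toSet).Nonempty ∧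
    ∀ w, w ≠ u → w ≠ v → Disjoint (segment ℝ p q) (R w).toSet

/-- An integer rectangle visibility representation of `G`: integer rectangles indexed by the
vertices, with pairwise disjoint interiors (rectangles may share boundary points), such that two
distinct vertices are adjacent if and only if their rectangles see each other. -/
structure RVRepresentation {V : Type*} (G : SimpleGraph V) where
  rect : V → IntRect
  disjoint_interior : ∀ u v, u ≠ v → Disjoint (interior (rect u).toSet) (interior (rect v).toSet)
  adj_iff : ∀ u v, u ≠ v → (G.Adj u v ↔ Sees rect u v)

/-- `B` is the bounding box of the family `R`: it contains all the rectangles of the family and is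
contained in every rectangle with horizontal and vertical sides that does.  (For points
`a b : ℝ × ℝ`, `Set.Icc a b` is `[a.1, b.1] × [a.2, b.2]`.) -/
def IsBoundingBox {V : Type*} (R : V → IntRect) (B : IntRect) : Prop :=
  (∀ v, (R v).toSet ⊆ B.toSet) ∧
    ∀ a b : ℝ × ℝ, (∀ v, (R v).toSet ⊆ Set.Icc a b) → B.toSet ⊆ Set.Icc a b

/-- The bounding boxes, turned so that the height is at most the width, of the integer rectangle
visibility representations of `G`. -/
def boundingBoxes {V : Type*} (G : SimpleGraph V) : Set IntRect :=
  {B | ∃ S : RVRepresentation G, IsBoundingBox S.rect B ∧ B.height ≤ B.width}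

/-- `height(G) = m`: `m` is the minimum height of a bounding box in `boundingBoxes G`. -/
def HeightEq {V : Type*} (G : SimpleGraph V) (m : ℤ) : Prop :=
  IsLeast (IntRect.height '' boundingBoxes G) m

/-- `width(G) = m`. -/
def WidthEq {V : Type*} (G : SimpleGraph V) (m : ℤ) : Prop :=
  IsLeast (IntRect.width '' boundingBoxes G) m

/-- `area(G) = m`. -/
def AreaEq {V : Type*} (G : SimpleGraph V) (m : ℤ) : Prop :=
  IsLeast (IntRect.area '' boundingBoxes G) m

/-- `perimeter(G) = m`. -/
def PerimeterEq {V : Type*} (G : SimpleGraph V) (m : ℤ) : Prop :=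
  IsLeast (IntRect.perimeter '' boundingBoxes G) m

/-! Because corners are integral, visibility can be tested on unit rows and unit columns. When all
pairs see each other, two rectangles overlap in rows or in columns, never in both, and a pair
overlapping in rows must see each other horizontally. At most four rectangles overlap pairwise in
rows (`card_le_four_of_rowOverlap`), and likewise in columns, while the family always splits into a
row clique and a column clique (`exists_split`). So eight rectangles consist of four `k j` crossing
a row `c` and four `i j` crossing a column `d`.

Blocking arguments put two of the `k j` on each side of `d` (`second_left`, `third_right`) and two
of the `i j` on each side of `c`; up to reflection the inner four form a pinwheel. Its sight lines
force eight strictly increasing edge heights (`chain` and its half turn), hence seven units. The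
outer rectangles `i 0` and `i 3` add one unit each, and the row along which `k 0` sees `k 3` is the
tenth. The width bound follows from height ≤ width, and one explicit family attains everything. -/

namespace IntRect

/-- The mirror image in the diagonal `x = y`. -/
def transpose (A : IntRect) : IntRect := ⟨A.y₁, A.y₂, A.x₁, A.x₂, A.hy, A.hx⟩

/-- The mirror image in the vertical axis. -/
def reflectX (A : IntRect) : IntRect :=
  ⟨-A.x₂, -A.x₁, A.y₁, A.y₂, neg_lt_neg A.hx, A.hy⟩

/-- The mirror image in the horizontal axis. -/
def reflectY (A : IntRect) : IntRect :=
  ⟨A.x₁, A.x₂, -A.y₂, -A.y₁, A.hx, neg_lt_neg A.hy⟩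

theorem interior_toSet (A : IntRect) :
    interior A.toSet = Set.Ioo (A.x₁ : ℝ) A.x₂ ×ˢ Set.Ioo (A.y₁ : ℝ) A.y₂ := by
  rw [toSet, interior_prod_eq, interior_Icc, interior_Icc]

theorem mem_toSet {A : IntRect} {p : ℝ × ℝ} :
    p ∈ A.toSet ↔ ((A.x₁ : ℝ) ≤ p.1 ∧ p.1 ≤ A.x₂) ∧ (A.y₁ : ℝ) ≤ p.2 ∧ p.2 ≤ A.y₂ := Iff.rfl

theorem mem_interior_toSet {A : IntRect} {p : ℝ × ℝ} :
    p ∈ interior A.toSet ↔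
      ((A.x₁ : ℝ) < p.1 ∧ p.1 < A.x₂) ∧ (A.y₁ : ℝ) < p.2 ∧ p.2 < A.y₂ := by
  rw [interior_toSet]; rfl

theorem swap_mem_toSet_transpose {A : IntRect} {p : ℝ × ℝ} :
    p.swap ∈ A.transpose.toSet ↔ p ∈ A.toSet := by
  rw [mem_toSet, mem_toSet]; exact and_comm

theorem swap_mem_interior_toSet_transpose {A : IntRect} {p : ℝ × ℝ} :
    p.swap ∈ interior A.transpose.toSet ↔ p ∈ interior A.toSet := by
  rw [mem_interior_toSet, mem_interior_toSet]; exact and_comm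

/-- Two rectangles are disjoint up to boundary as soon as a coordinate separates them. -/
def Separated (A B : IntRect) : Prop :=
  A.x₂ ≤ B.x₁ ∨ B.x₂ ≤ A.x₁ ∨ A.y₂ ≤ B.y₁ ∨ B.y₂ ≤ A.y₁

instance (A B : IntRect) : Decidable (Separated A B) := by unfold Separated; infer_instance

theorem disjoint_interior_iff (A B : IntRect) :
    Disjoint (interior A.toSet) (interior B.toSet) ↔ Separated A B := by
  have hA := A.hx
  have hA' := A.hy
  have hB := B.hx
  have hB' := B.hy
  rw [interior_toSet, interior_toSet, Set.disjoint_prod, Set.Ioo_disjoint_Ioo,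
    Set.Ioo_disjoint_Ioo]
  norm_cast
  unfold Separated
  omega

end IntRect

/-! ### Reduction of visibility to unit rows and columns. -/

section Visibility

variable {V : Type*}

/-- The rectangles `R u` and `R v` see each other along the unit row `[r, r + 1]`. -/
def RowVisibleAt (R : V → IntRect) (u v : V) (r : ℤ) : Prop :=
  ((R u).y₁ ≤ r ∧ r < (R u).y₂) ∧ ((R v).y₁ ≤ r ∧ r < (R v).y₂) ∧
    ∀ w, (R w).y₁ ≤ r → r < (R w).y₂ →
      ¬((R u).x₂ ≤ (R w).x₁ ∧ (R w).x₂ ≤ (R v).x₁) ∧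
      ¬((R v).x₂ ≤ (R w).x₁ ∧ (R w).x₂ ≤ (R u).x₁)

instance [Fintype V] (R : V → IntRect) (u v : V) (r : ℤ) : Decidable (RowVisibleAt R u v r) := by
  unfold RowVisibleAt; infer_instance

/-- The rectangles `R u` and `R v` see each other along some unit row. -/
def RowVisible (R : V → IntRect) (u v : V) : Prop := ∃ r, RowVisibleAt R u v r

/-- The rectangles `R u` and `R v` see each other along a unit column. -/
def ColVisible (R : V → IntRect) (u v : V) : Prop :=
  RowVisible (fun w => (R w).transpose) u v

/-- Some unit row meets both rectangles. -/
def RowOverlap (R : V → IntRect) (u v : V) : Prop :=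
  (R u).y₁ < (R v).y₂ ∧ (R v).y₁ < (R u).y₂

/-- Some unit column meets both rectangles. -/
def ColOverlap (R : V → IntRect) (u v : V) : Prop :=
  (R u).x₁ < (R v).x₂ ∧ (R v).x₁ < (R u).x₂

/-- The rectangles `R u` and `R v` see each other along a horizontal segment. -/
def HorizontallySees (R : V → IntRect) (u v : V) : Prop :=
  ∃ p q : ℝ × ℝ, p.2 = q.2 ∧
    (segment ℝ p q ∩ interior (R u).toSet).Nonempty ∧
    (segment ℝ p q ∩ interior (R v).toSet).Nonempty ∧
    ∀ w, w ≠ u → w ≠ v → Disjoint (segment ℝ p q) (R w).toSet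

theorem swap_mem_segment_swap {p q z : ℝ × ℝ} :
    z.swap ∈ segment ℝ p.swap q.swap ↔ z ∈ segment ℝ p q := by
  have h : ∀ p q z : ℝ × ℝ, z ∈ segment ℝ p q → z.swap ∈ segment ℝ p.swap q.swap := by
    rintro p q _ ⟨a, b, ha, hb, hab, rfl⟩
    exact ⟨a, b, ha, hb, hab, rfl⟩
  exact ⟨h _ _ _, h _ _ _⟩

theorem segment_swap_inter_nonempty {p q : ℝ × ℝ} {A B : Set (ℝ × ℝ)}
    (h : ∀ z : ℝ × ℝ, z.swap ∈ B ↔ z ∈ A) :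
    (segment ℝ p.swap q.swap ∩ B).Nonempty ↔ (segment ℝ p q ∩ A).Nonempty := by
  constructor
  · rintro ⟨z, hz, hzB⟩
    exact ⟨z.swap, swap_mem_segment_swap.1 hz, (h z.swap).1 hzB⟩
  · rintro ⟨z, hz, hzA⟩
    exact ⟨z.swap, swap_mem_segment_swap.2 hz, (h z).2 hzA⟩

/-- A vertical segment is a horizontal one for the transposed family, so only horizontal sight lines
need analysis. -/
theorem sees_iff {R : V → IntRect} {u v : V} :
    Sees R u v ↔ HorizontallySees R u v ∨ HorizontallySees (fun w => (R w).transpose) u v := by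
  have key : ∀ p q : ℝ × ℝ,
      ((segment ℝ p.swap q.swap ∩ interior (R u).transpose.toSet).Nonempty ∧
        (segment ℝ p.swap q.swap ∩ interior (R v).transpose.toSet).Nonempty ∧
        ∀ w, w ≠ u → w ≠ v → Disjoint (segment ℝ p.swap q.swap) (R w).transpose.toSet) ↔
      ((segment ℝ p q ∩ interior (R u).toSet).Nonempty ∧
        (segment ℝ p q ∩ interior (R v).toSet).Nonempty ∧
        ∀ w, w ≠ u → w ≠ v → Disjoint (segment ℝ p q) (R w).toSet) := by
    intro p q
    simp only [← Set.not_nonempty_iff_eq_empty, Set.disjoint_iff_inter_eq_empty,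
      segment_swap_inter_nonempty fun _ => IntRect.swap_mem_interior_toSet_transpose,
      segment_swap_inter_nonempty fun _ => IntRect.swap_mem_toSet_transpose]
  constructor
  · rintro ⟨p, q, hpq | hpq, h⟩
    · exact .inr ⟨p.swap, q.swap, hpq, (key p q).2 h⟩
    · exact .inl ⟨p, q, hpq, h⟩
  · rintro (⟨p, q, hpq, h⟩ | ⟨p, q, hpq, h⟩)
    · exact ⟨p, q, .inr hpq, h⟩
    · exact ⟨p.swap, q.swap, .inl hpq, (key p.swap q.swap).1 h⟩

theorem mem_segment_of_snd_eq {P Q : ℝ × ℝ} (h : P.2 = Q.2) {x : ℝ} (hP : P.1 ≤ x)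
    (hQ : x ≤ Q.1) : (x, P.2) ∈ segment ℝ P Q := by
  obtain ⟨a, b⟩ := P
  obtain ⟨c, d⟩ := Q
  obtain rfl : b = d := h
  rw [← Prod.image_mk_segment_left, segment_eq_Icc (hP.trans hQ)]
  exact ⟨x, ⟨hP, hQ⟩, rfl⟩

/-- The row is the floor of the segment's height. Blockers are closed, so one occupying that row
meets the segment even when the height is an integer. -/
theorem HorizontallySees.rowVisible {R : V → IntRect} {u v : V} (h : HorizontallySees R u v) :
    RowVisible R u v := by
  obtain ⟨p, q, hpq, ⟨P, hP, hPu⟩, ⟨Q, hQ, hQv⟩, hw⟩ := h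
  rw [IntRect.mem_interior_toSet] at hPu hQv
  have hsnd : ∀ z ∈ segment ℝ p q, z.2 = p.2 := by
    rintro _ ⟨a, b, -, -, hab, rfl⟩
    simp [← hpq, ← add_mul, hab]
  have hP2 := hsnd P hP
  have hQ2 := hsnd Q hQ
  rw [hP2] at hPu
  rw [hQ2] at hQv
  have key : ∀ A B : ℝ × ℝ, A ∈ segment ℝ p q → B ∈ segment ℝ p q → ∀ w, w ≠ u → w ≠ v →
      (R w).y₁ ≤ ⌊p.2⌋ → ⌊p.2⌋ < (R w).y₂ → A.1 ≤ (R w).x₁ → (R w).x₁ ≤ B.1 → False := by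
    intro A B hA hB w hwu hwv h1 h2 hAw hwB
    have hmem := mem_segment_of_snd_eq ((hsnd A hA).trans (hsnd B hB).symm) hAw hwB
    refine Set.disjoint_left.1 (hw w hwu hwv)
      ((convex_segment p q).segment_subset hA hB hmem) ?_
    rw [IntRect.mem_toSet, hsnd A hA]
    exact ⟨⟨le_rfl, Int.cast_le.2 (R w).hx.le⟩, Int.le_floor.1 h1, (Int.floor_lt.1 h2).le⟩
  have aux : ∀ {a b : ℤ}, (a : ℝ) < p.2 ∧ p.2 < b → a ≤ ⌊p.2⌋ ∧ ⌊p.2⌋ < b := fun h =>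
    ⟨Int.le_floor.2 h.1.le, Int.floor_lt.2 h.2⟩
  refine ⟨⌊p.2⌋, aux hPu.2, aux hQv.2, fun w h1 h2 => ⟨fun h => ?_, fun h => ?_⟩⟩
  all_goals
    have hwu : w ≠ u := by
      rintro rfl
      have := (R w).hx
      omega
    have hwv : w ≠ v := by
      rintro rfl
      have := (R w).hx
      omega
    have h3 : ((R w).x₁ : ℝ) < (R w).x₂ := by exact_mod_cast (R w).hx
  · have h4 : ((R u).x₂ : ℝ) ≤ (R w).x₁ := by exact_mod_cast h.1
    have h5 : ((R w).x₂ : ℝ) ≤ (R v).x₁ := by exact_mod_cast h.2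
    exact key P Q hP hQ w hwu hwv h1 h2 (by linarith [hPu.1.2]) (by linarith [hQv.1.1])
  · have h4 : ((R v).x₂ : ℝ) ≤ (R w).x₁ := by exact_mod_cast h.1
    have h5 : ((R w).x₂ : ℝ) ≤ (R u).x₁ := by exact_mod_cast h.2
    exact key Q P hQ hP w hwu hwv h1 h2 (by linarith [hQv.1.2]) (by linarith [hPu.1.1])

theorem RowVisible.symm {R : V → IntRect} {u v : V} (h : RowVisible R u v) :
    RowVisible R v u := by
  obtain ⟨r, hu, hv, hw⟩ := h
  exact ⟨r, hv, hu, fun w h1 h2 => (hw w h1 h2).symm⟩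

theorem RowVisible.rowOverlap {R : V → IntRect} {u v : V} (h : RowVisible R u v) :
    RowOverlap R u v := by
  obtain ⟨r, hu, hv, -⟩ := h
  exact ⟨hu.1.trans_lt hv.2, hv.1.trans_lt hu.2⟩

theorem HorizontallySees.symm {R : V → IntRect} {u v : V} (h : HorizontallySees R u v) :
    HorizontallySees R v u := by
  obtain ⟨p, q, hpq, hu, hv, hw⟩ := h
  exact ⟨p, q, hpq, hv, hu, fun w h1 h2 => hw w h2 h1⟩

theorem RowVisible.horizontallySees {R : V → IntRect}
    (hR : ∀ u v, u ≠ v → (R u).Separated (R v)) {u v : V} (huv : u ≠ v)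
    (h : RowVisible R u v) : HorizontallySees R u v := by
  wlog hle : (R u).x₂ ≤ (R v).x₁ generalizing u v
  · refine (this huv.symm h.symm ?_).symm
    have h1 := hR u v huv
    have h2 := h.rowOverlap
    unfold IntRect.Separated at h1
    unfold RowOverlap at h2
    omega
  obtain ⟨r, hu, hv, hw⟩ := h
  have hxu := (R u).hx
  have hxv := (R v).hx
  have e1 : ((R u).x₁ : ℝ) < (R u).x₂ := by exact_mod_cast hxu
  have e2 : ((R v).x₁ : ℝ) < (R v).x₂ := by exact_mod_cast hxv
  have inRow : ∀ {a b : ℤ}, a ≤ r ∧ r < b → (a : ℝ) < r + 1 / 2 ∧ (r : ℝ) + 1 / 2 < b := by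
    rintro a b ⟨h1, h2⟩
    have h1' : (a : ℝ) ≤ r := by exact_mod_cast h1
    have h2' : (r : ℝ) + 1 ≤ b := by exact_mod_cast h2
    constructor <;> linarith
  -- Height `r + 1/2` keeps the segment off rectangles that only touch the row's boundary.
  refine ⟨(((R u).x₁ + (R u).x₂) / 2, r + 1 / 2), (((R v).x₁ + (R v).x₂) / 2, r + 1 / 2), rfl,
    ⟨_, left_mem_segment _ _ _, ?_⟩, ⟨_, right_mem_segment _ _ _, ?_⟩, ?_⟩
  · rw [IntRect.mem_interior_toSet]
    exact ⟨⟨by simp only; linarith, by simp only; linarith⟩, inRow hu⟩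
  · rw [IntRect.mem_interior_toSet]
    exact ⟨⟨by simp only; linarith, by simp only; linarith⟩, inRow hv⟩
  · intro w hwu hwv
    rw [Set.disjoint_left]
    intro z hz hzw
    have hle' : ((R u).x₂ : ℝ) ≤ (R v).x₁ := by exact_mod_cast hle
    rw [← Prod.image_mk_segment_left, segment_eq_Icc (by linarith)] at hz
    obtain ⟨x, ⟨hx1, hx2⟩, rfl⟩ := hz
    rw [IntRect.mem_toSet] at hzw
    obtain ⟨⟨h1, h2⟩, h3, h4⟩ := hzw
    simp only at h1 h2 h3 h4
    have h3' : (R w).y₁ ≤ r := by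
      by_contra hcon
      have : (r : ℝ) + 1 ≤ (R w).y₁ := by exact_mod_cast not_le.1 hcon
      linarith
    have h4' : r < (R w).y₂ := by
      by_contra hcon
      have : ((R w).y₂ : ℝ) ≤ r := by exact_mod_cast not_lt.1 hcon
      linarith
    have h5 : (R u).x₁ < (R w).x₂ := by
      have : ((R u).x₁ : ℝ) < (R w).x₂ := by linarith
      exact_mod_cast this
    have h6 : (R w).x₁ < (R v).x₂ := by
      have : ((R w).x₁ : ℝ) < (R v).x₂ := by linarith
      exact_mod_cast this
    have h7 := hR u w hwu.symm
    have h8 := hR v w hwv.symm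
    have h9 := hw w h3' h4'
    unfold IntRect.Separated at h7 h8
    omega

theorem Sees.rowVisible_or_colVisible {R : V → IntRect} {u v : V} (h : Sees R u v) :
    RowVisible R u v ∨ ColVisible R u v :=
  (sees_iff.1 h).imp HorizontallySees.rowVisible HorizontallySees.rowVisible

theorem IntRect.Separated.transpose {A B : IntRect} (h : A.Separated B) :
    A.transpose.Separated B.transpose := by
  unfold IntRect.Separated IntRect.transpose at *
  tauto

theorem sees_of_rowVisible_or_colVisible {R : V → IntRect}
    (hR : ∀ u v, u ≠ v → (R u).Separated (R v)) {u v : V} (huv : u ≠ v)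
    (h : RowVisible R u v ∨ ColVisible R u v) : Sees R u v :=
  sees_iff.2 (h.imp (fun h => h.horizontallySees hR huv)
    (fun h => h.horizontallySees (fun a b hab => (hR a b hab).transpose) huv))

end Visibility

/-! ### Cliques in the row and column overlap relations. -/

section CompleteFamily

variable {V : Type*} {R : V → IntRect}

/-- A family of rectangles, pairwise separated, any two of which see each other along a unit row
or a unit column. -/
structure IsCompleteFamily (R : V → IntRect) : Prop where
  separated : ∀ u v, u ≠ v → (R u).Separated (R v)
  visible : ∀ u v, u ≠ v → RowVisible R u v ∨ ColVisible R u v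

namespace IsCompleteFamily

theorem transpose (h : IsCompleteFamily R) : IsCompleteFamily fun v => (R v).transpose where
  separated u v huv := (h.separated u v huv).transpose
  visible u v huv := (h.visible u v huv).symm

theorem reflectX (h : IsCompleteFamily R) : IsCompleteFamily fun v => (R v).reflectX where
  separated u v huv := by
    have := h.separated u v huv
    simp only [IntRect.Separated, IntRect.reflectX] at *
    omega
  visible u v huv := by
    refine (h.visible u v huv).imp ?_ ?_
    · rintro ⟨r, hu, hv, hw⟩
      refine ⟨r, hu, hv, fun w h1 h2 => ?_⟩
      have := hw w h1 h2
      simp only [IntRect.reflectX]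
      omega
    · rintro ⟨r, hu, hv, hw⟩
      -- Negation carries the unit interval `[r, r + 1]` to `[-r - 1, -r]`.
      refine ⟨-r - 1, ?_, ?_, fun w h1 h2 => ?_⟩
      · simp only [IntRect.reflectX, IntRect.transpose] at *
        omega
      · simp only [IntRect.reflectX, IntRect.transpose] at *
        omega
      · simp only [IntRect.reflectX, IntRect.transpose] at *
        exact hw w (by omega) (by omega)

theorem reflectY (h : IsCompleteFamily R) : IsCompleteFamily fun v => (R v).reflectY :=
  h.transpose.reflectX.transpose

theorem not_rowOverlap_and_colOverlap (h : IsCompleteFamily R) {u v : V} (huv : u ≠ v) :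
    ¬(RowOverlap R u v ∧ ColOverlap R u v) := by
  have := h.separated u v huv
  unfold IntRect.Separated at this
  unfold RowOverlap ColOverlap
  omega

theorem rowVisible (h : IsCompleteFamily R) {u v : V} (huv : u ≠ v) (hrow : RowOverlap R u v) :
    RowVisible R u v :=
  (h.visible u v huv).resolve_right fun hc =>
    h.not_rowOverlap_and_colOverlap huv ⟨hrow, hc.rowOverlap⟩

theorem rowOverlap_or_colOverlap (h : IsCompleteFamily R) {u v : V} (huv : u ≠ v) :
    RowOverlap R u v ∨ ColOverlap R u v :=
  (h.visible u v huv).imp RowVisible.rowOverlap RowVisible.rowOverlap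

theorem left_or_right (h : IsCompleteFamily R) {u v : V} (huv : u ≠ v)
    (hrow : RowOverlap R u v) : (R u).x₂ ≤ (R v).x₁ ∨ (R v).x₂ ≤ (R u).x₁ := by
  have := h.separated u v huv
  unfold IntRect.Separated at this
  unfold RowOverlap at hrow
  omega

end IsCompleteFamily

/-- Finitely many pairwise disjoint nonempty half-open intervals can be listed from left to
right. -/
theorem exists_sorted_enumeration {f g : V → ℤ} (hfg : ∀ v, f v < g v) {s : Finset V} {n : ℕ}
    (hs : s.card = n) (hsep : ∀ u ∈ s, ∀ v ∈ s, u ≠ v → g u ≤ f v ∨ g v ≤ f u) :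
    ∃ e : Fin n → V, (∀ j, e j ∈ s) ∧ ∀ j j', j < j' → g (e j) ≤ f (e j') := by
  have hinj : Set.InjOn f s := by
    intro u hu v hv huv
    by_contra hne
    have h1 := hsep u hu v hv hne
    have h2 := hfg u
    have h3 := hfg v
    omega
  have hcard : (s.image f).card = n := (Finset.card_image_of_injOn hinj).trans hs
  choose e hes hef using fun j =>
    Finset.mem_image.1 (Finset.orderEmbOfFin_mem (s.image f) hcard j)
  refine ⟨e, hes, fun j j' hjj => ?_⟩
  have hlt : f (e j) < f (e j') := by
    rw [hef, hef]
    exact (Finset.orderEmbOfFin _ hcard).strictMono hjj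
  have h1 := hsep _ (hes j) _ (hes j') (by rintro heq; rw [heq] at hlt; exact hlt.false)
  have h2 := hfg (e j')
  omega

namespace IsCompleteFamily

theorem exists_row_of_between (h : IsCompleteFamily R) {u w v : V} (huw : (R u).x₂ ≤ (R w).x₁)
    (hwv : (R w).x₂ ≤ (R v).x₁) (hrow : RowOverlap R u v) :
    ∃ r, ((R u).y₁ ≤ r ∧ r < (R u).y₂) ∧ ((R v).y₁ ≤ r ∧ r < (R v).y₂) ∧
      ∀ w, (R u).x₂ ≤ (R w).x₁ → (R w).x₂ ≤ (R v).x₁ → r < (R w).y₁ ∨ (R w).y₂ ≤ r := by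
  have hne : u ≠ v := by
    rintro rfl
    have h1 := (R u).hx
    have h2 := (R w).hx
    omega
  obtain ⟨r, hu, hv, hw⟩ := h.rowVisible hne hrow
  refine ⟨r, hu, hv, fun w h1 h2 => ?_⟩
  by_contra hcon
  have := hw w (by omega) (by omega)
  omega

/-- At most four members of a complete family can overlap in rows pairwise. -/
theorem card_le_four_of_rowOverlap (h : IsCompleteFamily R) {s : Finset V}
    (hs : ∀ u ∈ s, ∀ v ∈ s, u ≠ v → RowOverlap R u v) : s.card ≤ 4 := by
  by_contra hcon
  obtain ⟨t, hts, ht⟩ := Finset.exists_subset_card_eq (show 5 ≤ s.card by omega)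
  obtain ⟨e, het, he⟩ := exists_sorted_enumeration (fun v => (R v).hx) ht
    fun u hu v hv huv => h.left_or_right huv (hs u (hts hu) v (hts hv) huv)
  have hrow : ∀ j j', j < j' → RowOverlap R (e j) (e j') := by
    intro j j' hjj
    refine hs _ (hts (het j)) _ (hts (het j')) fun heq => ?_
    have h1 := he j j' hjj
    have h2 := (R (e j')).hx
    rw [heq] at h1
    omega
  have hvis : ∀ a b c : Fin 5, a < b → b < c → _ := fun a b c hab hbc =>
    h.exists_row_of_between (he a b hab) (he b c hbc) (hrow a c (hab.trans hbc))
  -- All five share a row, so each sight line passes entirely above or entirely below what it skips.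
  -- Sights 0–3 and 1–4 cannot use the same side, since 3 would reach beyond 1 and 1 beyond 3. Say
  -- 0–3 goes above and 1–4 below. Then 0–2 passes above 1, so 2 is higher than 1; hence 1–3 passes
  -- below 2, so 3 extends beyond 2 both ways and blocks 2–4.
  obtain ⟨r₁, h11, h12, h13⟩ := hvis 0 1 2 (by decide) (by decide)
  obtain ⟨r₂, h21, h22, h23⟩ := hvis 1 2 3 (by decide) (by decide)
  obtain ⟨r₃, h31, h32, h33⟩ := hvis 2 3 4 (by decide) (by decide)
  obtain ⟨r₄, h41, h42, h43⟩ := hvis 0 1 3 (by decide) (by decide)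
  obtain ⟨r₅, h51, h52, h53⟩ := hvis 1 2 4 (by decide) (by decide)
  have g1 := h13 (e 1) (he _ _ (by decide)) (he _ _ (by decide))
  have g2 := h23 (e 2) (he _ _ (by decide)) (he _ _ (by decide))
  have g3 := h33 (e 3) (he _ _ (by decide)) (he _ _ (by decide))
  have g4 := h43 (e 1) (he _ _ (by decide)) (he _ _ (by decide))
  have g4' := h43 (e 2) (he _ _ (by decide)) (he _ _ (by decide))
  have g5 := h53 (e 2) (he _ _ (by decide)) (he _ _ (by decide))
  have g5' := h53 (e 3) (he _ _ (by decide)) (he _ _ (by decide))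
  have o01 := hrow 0 1 (by decide)
  have o02 := hrow 0 2 (by decide)
  have o03 := hrow 0 3 (by decide)
  have o12 := hrow 1 2 (by decide)
  have o13 := hrow 1 3 (by decide)
  have o14 := hrow 1 4 (by decide)
  have o23 := hrow 2 3 (by decide)
  have o24 := hrow 2 4 (by decide)
  have o34 := hrow 3 4 (by decide)
  unfold RowOverlap at *
  clear h13 h23 h33 h43 h53 hrow he hvis hs
  omega

/-- At most four members of a complete family can overlap in columns pairwise. -/
theorem card_le_four_of_colOverlap (h : IsCompleteFamily R) {s : Finset V}
    (hs : ∀ u ∈ s, ∀ v ∈ s, u ≠ v → ColOverlap R u v) : s.card ≤ 4 :=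
  h.transpose.card_le_four_of_rowOverlap hs

end IsCompleteFamily

/-- Pairwise overlapping intervals have a common unit subinterval. -/
theorem exists_common_row {s : Finset V} (hne : s.Nonempty)
    (hs : ∀ u ∈ s, ∀ v ∈ s, u ≠ v → RowOverlap R u v) :
    ∃ c, ∀ v ∈ s, (R v).y₁ ≤ c ∧ c < (R v).y₂ := by
  obtain ⟨m, hm, hmax⟩ := s.exists_max_image (fun v => (R v).y₁) hne
  refine ⟨(R m).y₁, fun v hv => ⟨hmax v hv, ?_⟩⟩
  by_cases hmv : m = v
  · rw [← hmv]; exact (R m).hy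
  · exact (hs m hm v hv hmv).1

namespace IsCompleteFamily

open Classical in
/-- The vertices of a complete family split into a set whose members overlap in rows pairwise and a
set whose members overlap in columns pairwise. -/
theorem exists_split [Fintype V] (h : IsCompleteFamily R) :
    ∃ K : Finset V, (∀ u ∈ K, ∀ v ∈ K, u ≠ v → RowOverlap R u v) ∧
      ∀ u ∉ K, ∀ v ∉ K, u ≠ v → ColOverlap R u v := by
  by_cases hall : ∀ u v, u ≠ v → ¬RowOverlap R u v
  · exact ⟨∅, by simp, fun u _ v _ huv => (h.rowOverlap_or_colOverlap huv).resolve_left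
      (hall u v huv)⟩
  push Not at hall
  obtain ⟨u₀, v₀, huv₀, hrow₀⟩ := hall
  -- Sweep upward to the least `c` such that two rectangles with tops at most `c` overlap in rows.
  -- The row clique is what occupies the unit row just below `c`.
  let P : ℤ → Prop := fun c => ∃ u v, u ≠ v ∧ (R u).y₂ ≤ c ∧ (R v).y₂ ≤ c ∧ RowOverlap R u v
  obtain ⟨v₁, -, hv₁⟩ := Finset.univ.exists_min_image (fun v => (R v).y₂) ⟨u₀, Finset.mem_univ _⟩
  have hP : ∃ c, P c := ⟨max (R u₀).y₂ (R v₀).y₂, u₀, v₀, huv₀, le_max_left _ _, le_max_right _ _,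
    hrow₀⟩
  have hbdd : ∃ b, ∀ c, P c → b ≤ c := ⟨(R v₁).y₂, by
    rintro c ⟨u, -, -, hu, -⟩
    exact (hv₁ u (Finset.mem_univ _)).trans hu⟩
  obtain ⟨c, ⟨a, a', haa, hac, hac', hrow⟩, hmin⟩ := Int.exists_least_of_bdd hbdd hP
  have hbelow : ∀ u v, u ≠ v → (R u).y₂ < c → (R v).y₂ < c → ¬RowOverlap R u v := by
    intro u v huv hu hv huvrow
    have := hmin (c - 1) ⟨u, v, huv, by omega, by omega, huvrow⟩
    omega
  have hcover : ∀ w, c ≤ (R w).y₁ → ColOverlap R a w ∧ ColOverlap R a' w := by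
    intro w hw
    have hwy := (R w).hy
    constructor
    · have hne : a ≠ w := by rintro rfl; omega
      exact (h.rowOverlap_or_colOverlap hne).resolve_left fun ho => by have := ho.2; omega
    · have hne : a' ≠ w := by rintro rfl; omega
      exact (h.rowOverlap_or_colOverlap hne).resolve_left fun ho => by have := ho.2; omega
  -- `a` and `a'` lie side by side, and anything above `c` shares columns with both, so it extends
  -- past both facing edges; two such rectangles share columns.
  have habove : ∀ u v, u ≠ v → c ≤ (R u).y₁ → c ≤ (R v).y₁ → ColOverlap R u v := by
    intro u v huv hu hv
    have h1 := h.left_or_right haa hrow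
    have h2 := hcover u hu
    have h3 := hcover v hv
    have h4 := (R a).hx
    have h5 := (R a').hx
    unfold ColOverlap at *
    omega
  refine ⟨Finset.univ.filter fun v => (R v).y₁ < c ∧ c ≤ (R v).y₂, ?_, ?_⟩
  · intro u hu v hv _
    rw [Finset.mem_filter] at hu hv
    unfold RowOverlap
    omega
  · intro u hu v hv huv
    rw [Finset.mem_filter] at hu hv
    simp only [Finset.mem_univ, true_and, not_and, not_le] at hu hv
    by_cases hcol : c ≤ (R u).y₁ ∧ c ≤ (R v).y₁
    · exact habove u v huv hcol.1 hcol.2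
    · refine (h.rowOverlap_or_colOverlap huv).resolve_left fun ho => ?_
      by_cases hlow : (R u).y₂ < c ∧ (R v).y₂ < c
      · exact hbelow u v huv hlow.1 hlow.2 ho
      · unfold RowOverlap at ho
        omega

end IsCompleteFamily

end CompleteFamily

/-! ### Four rectangles across a row and four across a column. -/

section CrossConfig

variable {V : Type*} {R : V → IntRect} {k i : Fin 4 → V} {c d : ℤ}

/-- In a complete family, four rectangles `k` are met from left to right by the unit row `c`, and
four further rectangles `i` are met from bottom to top by the unit column `d`. -/
structure CrossConfig (R : V → IntRect) (k i : Fin 4 → V) (c d : ℤ) : Prop where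
  complete : IsCompleteFamily R
  row : ∀ j, (R (k j)).y₁ ≤ c ∧ c < (R (k j)).y₂
  col : ∀ j, (R (i j)).x₁ ≤ d ∧ d < (R (i j)).x₂
  k_sorted : ∀ j j', j < j' → (R (k j)).x₂ ≤ (R (k j')).x₁
  i_sorted : ∀ j j', j < j' → (R (i j)).y₂ ≤ (R (i j')).y₁
  ne : ∀ j j', k j ≠ i j'

open Classical in
theorem IsCompleteFamily.exists_crossConfig [Fintype V] (h : IsCompleteFamily R)
    (hV : Fintype.card V = 8) : ∃ k i c d, CrossConfig R k i c d := by
  obtain ⟨K, hK, hI⟩ := h.exists_split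
  replace hI : ∀ u ∈ Kᶜ, ∀ v ∈ Kᶜ, u ≠ v → ColOverlap R u v := fun u hu v hv =>
    hI u (Finset.mem_compl.1 hu) v (Finset.mem_compl.1 hv)
  have h1 := h.card_le_four_of_rowOverlap hK
  have h2 := h.card_le_four_of_colOverlap hI
  have h3 := Finset.card_add_card_compl K
  have hKcard : K.card = 4 := by omega
  have hIcard : Kᶜ.card = 4 := by omega
  obtain ⟨c, hc⟩ := exists_common_row (Finset.card_pos.1 (by omega)) hK
  obtain ⟨d, hd⟩ := exists_common_row (R := fun v => (R v).transpose)
    (Finset.card_pos.1 (by omega)) hI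
  obtain ⟨k, hk, hk'⟩ := exists_sorted_enumeration (fun v => (R v).hx) hKcard
    fun u hu v hv huv => h.left_or_right huv (hK u hu v hv huv)
  obtain ⟨i, hi, hi'⟩ := exists_sorted_enumeration (fun v => (R v).hy) hIcard
    fun u hu v hv huv => h.transpose.left_or_right huv (hI u hu v hv huv)
  exact ⟨k, i, c, d, h, fun j => hc _ (hk j), fun j => hd _ (hi j), hk', hi',
    fun j j' heq => Finset.mem_compl.1 (hi j') (heq ▸ hk j)⟩

namespace CrossConfig

theorem transpose (h : CrossConfig R k i c d) :
    CrossConfig (fun v => (R v).transpose) i k d c where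
  complete := h.complete.transpose
  row := h.col
  col := h.row
  k_sorted := h.i_sorted
  i_sorted := h.k_sorted
  ne j j' := (h.ne j' j).symm

theorem reflectX (h : CrossConfig R k i c d) :
    CrossConfig (fun v => (R v).reflectX) (k ∘ Fin.rev) i c (-d - 1) where
  complete := h.complete.reflectX
  row j := h.row _
  col j := by
    have := h.col j
    simp only [IntRect.reflectX]
    omega
  k_sorted j j' hjj := neg_le_neg (h.k_sorted _ _ (Fin.rev_lt_rev.2 hjj))
  i_sorted := h.i_sorted
  ne j j' := h.ne _ _

theorem reflectY (h : CrossConfig R k i c d) :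
    CrossConfig (fun v => (R v).reflectY) k (i ∘ Fin.rev) (-c - 1) d :=
  h.transpose.reflectX.transpose

theorem rowOverlap_k (h : CrossConfig R k i c d) (j j' : Fin 4) : RowOverlap R (k j) (k j') :=
  ⟨(h.row j).1.trans_lt (h.row j').2, (h.row j').1.trans_lt (h.row j).2⟩

theorem colOverlap_iff (h : CrossConfig R k i c d) (j j' : Fin 4) :
    ColOverlap R (k j) (i j') ↔ ¬RowOverlap R (k j) (i j') := by
  have h1 := h.complete.rowOverlap_or_colOverlap (h.ne j j')
  have h2 := h.complete.not_rowOverlap_and_colOverlap (h.ne j j')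
  tauto

open Classical in
-- Otherwise `i j` and the four `k j'` would be five rectangles overlapping pairwise in rows.
theorem exists_colOverlap (h : CrossConfig R k i c d) (j : Fin 4) :
    ∃ j', ColOverlap R (k j') (i j) := by
  by_contra hcon
  push Not at hcon
  have hrow : ∀ j', RowOverlap R (k j') (i j) := fun j' => by
    by_contra hr
    exact hcon j' ((h.colOverlap_iff _ _).2 hr)
  have hinj : Function.Injective k := by
    intro a b hab
    by_contra hne
    have h1 := (R (k a)).hx
    rcases lt_or_gt_of_ne hne with hlt | hlt
    all_goals
      have h2 := h.k_sorted _ _ hlt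
      rw [hab] at h1 h2
      omega
  have hmem : i j ∉ Finset.univ.image k := by
    simp only [Finset.mem_image, Finset.mem_univ, true_and, not_exists]
    exact fun j' => h.ne j' j
  have hcard := h.complete.card_le_four_of_rowOverlap (s := insert (i j) (Finset.univ.image k)) ?_
  · rw [Finset.card_insert_of_notMem hmem, Finset.card_image_of_injective _ hinj] at hcard
    simp at hcard
  · intro u hu v hv huv
    simp only [Finset.mem_insert, Finset.mem_image, Finset.mem_univ, true_and] at hu hv
    rcases hu with rfl | ⟨a, rfl⟩ <;> rcases hv with rfl | ⟨b, rfl⟩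
    · exact absurd rfl huv
    · exact (hrow b).symm
    · exact hrow a
    · exact h.rowOverlap_k a b

theorem exists_rowOverlap (h : CrossConfig R k i c d) (j : Fin 4) :
    ∃ j', RowOverlap R (k j) (i j') := by
  obtain ⟨j', hj'⟩ := h.transpose.exists_colOverlap j
  exact ⟨j', hj'.symm⟩

/-- The row `c` misses the rectangles `i`. -/
theorem below_or_above (h : CrossConfig R k i c d) (j : Fin 4) :
    (R (i j)).y₂ ≤ c ∨ c < (R (i j)).y₁ := by
  obtain ⟨j', hj'⟩ := h.exists_colOverlap j
  have h1 := h.row j'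
  rw [h.colOverlap_iff] at hj'
  unfold RowOverlap at hj'
  omega

/-- The column `d` misses the rectangles `k`. -/
theorem left_or_right (h : CrossConfig R k i c d) (j : Fin 4) :
    (R (k j)).x₂ ≤ d ∨ d < (R (k j)).x₁ :=
  h.transpose.below_or_above j

theorem exists_row (h : CrossConfig R k i c d) {a b b' : Fin 4} (hab : a < b) (hbb : b < b') :
    ∃ r, ((R (k a)).y₁ ≤ r ∧ r < (R (k a)).y₂) ∧ ((R (k b')).y₁ ≤ r ∧ r < (R (k b')).y₂) ∧
      ∀ w, (R (k a)).x₂ ≤ (R w).x₁ → (R w).x₂ ≤ (R (k b')).x₁ →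
        r < (R w).y₁ ∨ (R w).y₂ ≤ r :=
  h.complete.exists_row_of_between (h.k_sorted _ _ hab) (h.k_sorted _ _ hbb)
    (h.rowOverlap_k _ _)

/-- If `k 0` were right of `d`, an `i j` sharing rows with it would still have to share columns with
some `k j'`. Reaching from `d` to `k j'`, it would also share columns with `k 0`. -/
theorem first_left (h : CrossConfig R k i c d) : (R (k 0)).x₂ ≤ d := by
  by_contra hcon
  have h0 := (h.left_or_right 0).resolve_left hcon
  obtain ⟨j, hj⟩ := h.exists_rowOverlap 0
  obtain ⟨j', hj'⟩ := h.exists_colOverlap j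
  have h1 := h.col j
  refine h.complete.not_rowOverlap_and_colOverlap (h.ne 0 j) ⟨hj, ?_⟩
  rcases eq_or_ne j' 0 with rfl | hne
  · exact hj'
  · have h2 := h.k_sorted 0 j' (Fin.pos_iff_ne_zero.2 hne)
    have h3 := (R (k 0)).hx
    unfold ColOverlap at *
    omega

/-- If `k 1` were right of `d`, some `i j`, say above `c`, would share rows with it and so end to
its left. Then `i j` shares rows with `k 2` and `k 3` too, so it shares columns only with `k 0`,
which must stay below it. -/
theorem second_left (h : CrossConfig R k i c d) : (R (k 1)).x₂ ≤ d := by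
  by_contra hcon
  obtain ⟨j, hj⟩ := h.exists_rowOverlap 1
  wlog habove : c < (R (i j)).y₁ generalizing R i c j
  · refine this h.reflectY hcon (j.rev) ?_ ?_
    · unfold RowOverlap at *
      simp only [IntRect.reflectY, Function.comp_apply, Fin.rev_rev]
      omega
    · have := (h.below_or_above j).resolve_right habove
      simp only [IntRect.reflectY, Function.comp_apply, Fin.rev_rev]
      omega
  have h0 := h.first_left
  have h1 := (h.left_or_right 1).resolve_left hcon
  have hc := h.col j
  have s12 := h.k_sorted 1 2 (by decide)
  have s13 := h.k_sorted 1 3 (by decide)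
  have s23 := h.k_sorted 2 3 (by decide)
  have s01 := h.k_sorted 0 1 (by decide)
  have hx1 := (R (k 1)).hx
  have hx2 := (R (k 2)).hx
  have hij : (R (i j)).x₂ ≤ (R (k 1)).x₁ := by
    have := h.complete.left_or_right (h.ne 1 j) hj
    omega
  have hrow : ∀ m : Fin 4, 1 < m → RowOverlap R (k m) (i j) := by
    intro m hm
    by_contra hr
    rw [← h.colOverlap_iff] at hr
    have := h.k_sorted 1 m hm
    unfold ColOverlap at hr
    omega
  have r2 := hrow 2 (by decide)
  have r3 := hrow 3 (by decide)
  have hcol0 : ¬RowOverlap R (k 0) (i j) := by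
    rw [← h.colOverlap_iff]
    obtain ⟨m, hm⟩ := h.exists_colOverlap j
    rcases eq_or_ne m 0 with rfl | hm0
    · exact hm
    · refine absurd hm ?_
      rw [h.colOverlap_iff, not_not]
      rcases eq_or_ne m 1 with rfl | hm1
      · exact hj
      · exact hrow m (by omega)
  -- `k 0` is too low to see `k 2` above `k 1`, so `k 2` reaches lower than `k 1`. Hence `k 1` sees
  -- `k 3` above `k 2`, and its top is higher than that of `k 2`. But `i j` sees `k 2` above `k 1`,
  -- which needs the reverse.
  obtain ⟨r, hr0, hr2, hr⟩ := h.exists_row (a := 0) (b := 1) (b' := 2) (by decide) (by decide)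
  have g1 := hr (k 1) s01 s12
  obtain ⟨r', hr1', hr3', hr'⟩ := h.exists_row (a := 1) (b := 2) (b' := 3) (by decide) (by decide)
  have g2 := hr' (k 2) s12 s23
  obtain ⟨t, ht, ht2, htb⟩ := h.complete.exists_row_of_between hij s12 ⟨r2.2, r2.1⟩
  have g3 := htb (k 1) hij s12
  have c0 := h.row 0
  have c1 := h.row 1
  have c2 := h.row 2
  have c3 := h.row 3
  unfold RowOverlap at *
  clear hr hr' htb hrow
  omega

theorem third_right (h : CrossConfig R k i c d) : d < (R (k 2)).x₁ := by
  have := h.reflectX.second_left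
  simp only [IntRect.reflectX, Function.comp_apply, show Fin.rev (1 : Fin 4) = 2 from rfl] at this
  omega

end CrossConfig

/-! ### The pinwheel and its forced heights. -/

/-- A cross configuration whose four innermost rectangles form a pinwheel: the second rectangle in
the row is beside the second one in the column. -/
structure Pinwheel (R : V → IntRect) (k i : Fin 4 → V) (c d : ℤ) : Prop
    extends CrossConfig R k i c d where
  beside : RowOverlap R (k 1) (i 1)

namespace Pinwheel

theorem left (h : Pinwheel R k i c d) : (R (k 1)).x₂ ≤ d := h.second_left
theorem right (h : Pinwheel R k i c d) : d < (R (k 2)).x₁ := h.third_right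
theorem below (h : Pinwheel R k i c d) : (R (i 1)).y₂ ≤ c := h.transpose.second_left
theorem above (h : Pinwheel R k i c d) : c < (R (i 2)).y₁ := h.transpose.third_right

theorem left_of (h : Pinwheel R k i c d) : (R (k 1)).x₂ ≤ (R (i 1)).x₁ := by
  have h1 := h.complete.left_or_right (h.ne 1 1) h.beside
  have h2 := h.left
  have h3 := h.col 1
  have h4 := (R (k 1)).hx
  omega

/-- `i 1` shares columns with some `k m`. Being to the right of `k 0` and `k 1`, it must reach `k 2`
or `k 3`, and either way it shares columns with `k 2`. -/
theorem under (h : Pinwheel R k i c d) : (R (i 1)).y₂ ≤ (R (k 2)).y₁ := by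
  suffices hcol : ColOverlap R (k 2) (i 1) by
    rw [h.colOverlap_iff] at hcol
    have h1 := h.below
    have h2 := h.row 2
    have h3 := (R (i 1)).hy
    unfold RowOverlap at hcol
    omega
  obtain ⟨m, hm⟩ := h.exists_colOverlap 1
  have h1 := h.left_of
  have h2 := h.col 1
  have h3 := h.right
  have h4 := (R (k 2)).hx
  have s01 := h.k_sorted 0 1 (by decide)
  have s23 := h.k_sorted 2 3 (by decide)
  have h5 := (R (k 1)).hx
  unfold ColOverlap at *
  fin_cases m <;> simp at hm <;> omega

/-- The argument of `under` continued round the pinwheel: `k 2` lies above `i 1`, so sharing rows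
with some `i m` forces it up to `i 2`. Each later fact thus has a rotated counterpart. -/
theorem half_turn (h : Pinwheel R k i c d) :
    Pinwheel (fun v => (R v).reflectX.reflectY) (k ∘ Fin.rev) (i ∘ Fin.rev) (-c - 1) (-d - 1) where
  toCrossConfig := h.reflectX.reflectY
  beside := by
    suffices hrow : RowOverlap R (k 2) (i 2) from ⟨neg_lt_neg hrow.2, neg_lt_neg hrow.1⟩
    obtain ⟨m, hm⟩ := h.exists_rowOverlap 2
    have h1 := h.under
    have h2 := h.row 2
    have h3 := h.above
    have h4 := (R (i 2)).hy
    have s01 := h.i_sorted 0 1 (by decide)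
    have s23 := h.i_sorted 2 3 (by decide)
    have h5 := (R (i 1)).hy
    have h6 := (R (k 2)).hy
    unfold RowOverlap at *
    fin_cases m <;> simp at hm <;> omega

theorem atop (h : Pinwheel R k i c d) : (R (k 1)).y₂ ≤ (R (i 2)).y₁ :=
  neg_le_neg_iff.1 h.half_turn.under

/-- Otherwise `i 2` would stretch from the columns of `k 0` to `d`, covering all columns of `k 1`
and hiding `i 3` from it. -/
theorem rowOverlap_zero_two (h : Pinwheel R k i c d) : RowOverlap R (k 0) (i 2) := by
  by_contra hcon
  rw [← h.colOverlap_iff] at hcon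
  have h1 := h.atop
  have h2 := (R (i 2)).hy
  have s := h.i_sorted 2 3 (by decide)
  have hcol : ColOverlap R (k 1) (i 3) := by
    rw [h.colOverlap_iff]
    unfold RowOverlap
    omega
  obtain ⟨r, hr1, hr2, hr⟩ := h.complete.transpose.exists_row_of_between h1 s hcol
  have h3 := hr (i 2) h1 s
  have h4 := h.left
  have h5 := h.col 2
  have h6 := h.k_sorted 0 1 (by decide)
  unfold ColOverlap at hcon
  simp only [IntRect.transpose] at *
  clear hr
  omega

theorem rowOverlap_three_one (h : Pinwheel R k i c d) : RowOverlap R (k 3) (i 1) :=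
  ⟨neg_lt_neg_iff.1 h.half_turn.rowOverlap_zero_two.2,
    neg_lt_neg_iff.1 h.half_turn.rowOverlap_zero_two.1⟩

/-- `k 0` sees `i 1` past `k 1`, necessarily below `k 1`: the first inequality. The second is
`beside`. `k 1` sees `k 3` past both `i 1` and `k 2`; since `k 2` rises higher than `k 1`, that row
lies above `i 1` and below `k 2`: the third. -/
theorem chain (h : Pinwheel R k i c d) :
    (R (i 1)).y₁ < (R (k 1)).y₁ ∧ (R (k 1)).y₁ < (R (i 1)).y₂ ∧
      (R (i 1)).y₂ < (R (k 2)).y₁ := by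
  have h1 := h.left_of
  have h2 := h.right
  have h3 := h.below
  have h4 := h.above
  have h5 := h.under
  have h6 := h.atop
  have h7 := h.beside
  have h8 := h.col 1
  have s01 := h.k_sorted 0 1 (by decide)
  have s12 := h.k_sorted 1 2 (by decide)
  have s23 := h.k_sorted 2 3 (by decide)
  have c1 := h.row 1
  have c2 := h.row 2
  have hx1 := (R (k 1)).hx
  have hx2 := (R (k 2)).hx
  have hrow01 : RowOverlap R (k 0) (i 1) := by
    by_contra hcon
    rw [← h.colOverlap_iff] at hcon
    unfold ColOverlap at hcon
    omega
  have hrow31 := h.rowOverlap_three_one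
  have hi3 : (R (i 1)).x₂ ≤ (R (k 3)).x₁ := by
    have := h.complete.left_or_right (h.ne 3 1) hrow31
    have := (R (k 3)).hx
    omega
  have hrow22 := h.half_turn.beside
  obtain ⟨r, hr0, hr1, hr⟩ := h.complete.exists_row_of_between s01 h1 hrow01
  have g1 := hr (k 1) s01 h1
  obtain ⟨t, ht1, ht3, ht⟩ := h.exists_row (a := 1) (b := 2) (b' := 3) (by decide) (by decide)
  have g2 := ht (k 2) s12 s23
  have g3 := ht (i 1) h1 hi3
  unfold RowOverlap at *
  simp only [IntRect.reflectX, IntRect.reflectY, Function.comp_apply,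
    show Fin.rev (1 : Fin 4) = 2 from rfl] at hrow22
  clear hr ht
  omega

theorem ten_le (h : Pinwheel R k i c d) {a b : ℤ} (ha : ∀ v, a ≤ (R v).y₁)
    (hb : ∀ v, (R v).y₂ ≤ b) : 10 ≤ b - a := by
  have h1 := h.chain
  have h2 := h.half_turn.chain
  simp only [IntRect.reflectX, IntRect.reflectY, Function.comp_apply,
    show Fin.rev (1 : Fin 4) = 2 from rfl, show Fin.rev (2 : Fin 4) = 1 from rfl] at h2
  have h3 := h.left
  have h4 := h.right
  have s01 := h.k_sorted 0 1 (by decide)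
  have s12 := h.k_sorted 1 2 (by decide)
  have s13 := h.k_sorted 1 3 (by decide)
  have s02 := h.k_sorted 0 2 (by decide)
  have s23 := h.k_sorted 2 3 (by decide)
  have hx1 := (R (k 1)).hx
  have hx2 := (R (k 2)).hx
  obtain ⟨r, hr0, hr3, hr⟩ := h.exists_row (a := 0) (b := 1) (b' := 3) (by decide) (by decide)
  have hk1 := hr (k 1) s01 s13
  have hk2 := hr (k 2) s02 s23
  -- An `i j` occupying row `r` would cross column `d` between `k 0` and `k 3` and block their
  -- sight.
  have hi : ∀ j, r < (R (i j)).y₁ ∨ (R (i j)).y₂ ≤ r := by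
    intro j
    by_contra hcon
    have hrow0 : RowOverlap R (k 0) (i j) := ⟨by omega, by omega⟩
    have hrow3 : RowOverlap R (k 3) (i j) := ⟨by omega, by omega⟩
    have g0 := h.complete.left_or_right (h.ne 0 j) hrow0
    have g3 := h.complete.left_or_right (h.ne 3 j) hrow3
    have g := h.col j
    have h0x := (R (k 0)).hx
    have h3x := (R (k 3)).hx
    exact hcon (hr (i j) (by omega) (by omega))
  have hi0 := hi 0
  have hi1 := hi 1
  have hi2 := hi 2
  have hi3 := hi 3
  have t01 := h.i_sorted 0 1 (by decide)
  have t23 := h.i_sorted 2 3 (by decide)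
  have hy0 := (R (i 0)).hy
  have hy3 := (R (i 3)).hy
  have ai := ha (i 0)
  have bi := hb (i 3)
  have ak := ha (k 0)
  have bk := hb (k 0)
  have c1 := h.row 1
  have c2 := h.row 2
  have h5 := h.atop
  -- `i 1`, `k 1`, `k 2`, `i 2` cover every row from the bottom of `i 1` to the top of `i 2`, at
  -- least seven. Row `r` lies outside these and outside `i 0` and `i 3`, so 7 + 1 + 1 + 1 rows are
  -- needed.
  clear hr hi ha hb
  omega

end Pinwheel

/-- Since `k 1` crosses `c`, sharing rows with any `i m` means sharing them with `i 1` or `i 2`;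
reflection in the horizontal axis swaps the two cases. -/
theorem CrossConfig.ten_le (h : CrossConfig R k i c d) {a b : ℤ} (ha : ∀ v, a ≤ (R v).y₁)
    (hb : ∀ v, (R v).y₂ ≤ b) : 10 ≤ b - a := by
  by_cases hrow : RowOverlap R (k 1) (i 1)
  · exact (Pinwheel.mk h hrow).ten_le ha hb
  · have hrow' : RowOverlap R (k 1) (i 2) := by
      obtain ⟨m, hm⟩ := h.exists_rowOverlap 1
      have h1 : (R (i 1)).y₂ ≤ c := h.transpose.second_left
      have h2 : c < (R (i 2)).y₁ := h.transpose.third_right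
      have h3 := h.row 1
      have s01 := h.i_sorted 0 1 (by decide)
      have s23 := h.i_sorted 2 3 (by decide)
      have hy1 := (R (i 1)).hy
      have hy2 := (R (i 2)).hy
      unfold RowOverlap at *
      fin_cases m <;> simp at hm <;> omega
    have := (Pinwheel.mk h.reflectY ⟨neg_lt_neg hrow'.2, neg_lt_neg hrow'.1⟩).ten_le
      (fun v => neg_le_neg (hb v)) (fun v => neg_le_neg (ha v))
    omega

/-- Eight rectangles that see each other pairwise need height at least ten. -/
theorem IsCompleteFamily.ten_le_height [Fintype V] (h : IsCompleteFamily R)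
    (hV : Fintype.card V = 8) {B : IntRect}
    (hB : ∀ v, (R v).toSet ⊆ B.toSet) : 10 ≤ B.height := by
  obtain ⟨k, i, c, d, hc⟩ := h.exists_crossConfig hV
  have hmem : ∀ v, B.y₁ ≤ (R v).y₁ ∧ (R v).y₂ ≤ B.y₂ := by
    intro v
    have hx : ((R v).x₁ : ℝ) ≤ (R v).x₂ := Int.cast_le.2 (R v).hx.le
    have hy : ((R v).y₁ : ℝ) ≤ (R v).y₂ := Int.cast_le.2 (R v).hy.le
    have h1 : (((R v).x₁ : ℝ), ((R v).y₁ : ℝ)) ∈ B.toSet := hB v ⟨⟨le_rfl, hx⟩, le_rfl, hy⟩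
    have h2 : (((R v).x₁ : ℝ), ((R v).y₂ : ℝ)) ∈ B.toSet := hB v ⟨⟨le_rfl, hx⟩, hy, le_rfl⟩
    exact ⟨Int.cast_le.1 h1.2.1, Int.cast_le.1 h2.2.2⟩
  exact hc.ten_le (fun v => (hmem v).1) (fun v => (hmem v).2)

end CrossConfig

/-! ### The extremal representation and the four minima. -/

section CompleteGraph

theorem RVRepresentation.isCompleteFamily {V : Type*}
    (S : RVRepresentation (SimpleGraph.completeGraph V)) : IsCompleteFamily S.rect where
  separated u v huv := (IntRect.disjoint_interior_iff _ _).1 (S.disjoint_interior u v huv)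
  visible u v huv := ((S.adj_iff u v huv).1 huv).rowVisible_or_colVisible

/-- Eight rectangles with bounding box `[0, 10] × [0, 10]` that see each other pairwise. -/
def eightRects : Fin 8 → IntRect :=
  ![⟨0, 1, 0, 9, by decide, by decide⟩, ⟨1, 3, 3, 6, by decide, by decide⟩,
    ⟨6, 8, 5, 8, by decide, by decide⟩, ⟨9, 10, 0, 10, by decide, by decide⟩,
    ⟨1, 9, 0, 1, by decide, by decide⟩, ⟨4, 7, 2, 4, by decide, by decide⟩,
    ⟨2, 5, 7, 9, by decide, by decide⟩, ⟨0, 9, 9, 10, by decide, by decide⟩]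

theorem eightRects_separated : ∀ u v, u ≠ v → (eightRects u).Separated (eightRects v) := by
  decide

theorem eightRects_visible (u v : Fin 8) (huv : u ≠ v) :
    RowVisible eightRects u v ∨ ColVisible eightRects u v := by
  -- All coordinates lie in `[0, 10]`, so ten rows and ten columns suffice for a finite check.
  have key : ∀ u v : Fin 8, u ≠ v →
      (∃ r : Fin 10, RowVisibleAt eightRects u v (r : ℕ)) ∨
      ∃ r : Fin 10, RowVisibleAt (fun w => (eightRects w).transpose) u v (r : ℕ) := by
    decide +kernel
  exact (key u v huv).imp (fun ⟨r, h⟩ => ⟨r, h⟩) (fun ⟨r, h⟩ => ⟨r, h⟩)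

def eightRepresentation : RVRepresentation (SimpleGraph.completeGraph (Fin 8)) where
  rect := eightRects
  disjoint_interior u v huv :=
    (IntRect.disjoint_interior_iff _ _).2 (eightRects_separated u v huv)
  adj_iff u v huv := ⟨fun _ => sees_of_rowVisible_or_colVisible eightRects_separated huv
    (eightRects_visible u v huv), fun _ => huv⟩

def tenByTen : IntRect := ⟨0, 10, 0, 10, by decide, by decide⟩

theorem tenByTen_mem_boundingBoxes :
    tenByTen ∈ boundingBoxes (SimpleGraph.completeGraph (Fin 8)) := by
  refine ⟨eightRepresentation, ⟨fun v => ?_, fun a b hab => ?_⟩, le_rfl⟩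
  · have h : ∀ v, (0 ≤ (eightRects v).x₁ ∧ (eightRects v).x₂ ≤ 10) ∧
        0 ≤ (eightRects v).y₁ ∧ (eightRects v).y₂ ≤ 10 := by decide
    obtain ⟨⟨h1, h2⟩, h3, h4⟩ := h v
    exact Set.prod_mono (Set.Icc_subset_Icc (Int.cast_le.2 h1) (Int.cast_le.2 h2))
      (Set.Icc_subset_Icc (Int.cast_le.2 h3) (Int.cast_le.2 h4))
  · have h0 : ((0 : ℝ), (0 : ℝ)) ∈ Set.Icc a b :=
      hab 0 (by simp [eightRepresentation, eightRects, IntRect.mem_toSet])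
    have h10 : ((10 : ℝ), (10 : ℝ)) ∈ Set.Icc a b :=
      hab 3 ⟨⟨show ((9 : ℤ) : ℝ) ≤ 10 by norm_num, show (10 : ℝ) ≤ ((10 : ℤ) : ℝ) by norm_num⟩,
        show ((0 : ℤ) : ℝ) ≤ 10 by norm_num, show (10 : ℝ) ≤ ((10 : ℤ) : ℝ) by norm_num⟩
    rintro ⟨x, y⟩ ⟨⟨hx1, hx2⟩, hy1, hy2⟩
    simp only [tenByTen, Int.cast_zero, Int.cast_ofNat] at hx1 hx2 hy1 hy2
    exact ⟨h0.1.trans ⟨hx1, hy1⟩, le_trans (b := ((10 : ℝ), (10 : ℝ))) ⟨hx2, hy2⟩ h10.2⟩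

theorem ten_le_of_mem_boundingBoxes {B : IntRect}
    (hB : B ∈ boundingBoxes (SimpleGraph.completeGraph (Fin 8))) :
    10 ≤ B.height ∧ 10 ≤ B.width := by
  obtain ⟨S, hS, hle⟩ := hB
  have := S.isCompleteFamily.ten_le_height (Fintype.card_fin 8) hS.1
  exact ⟨this, this.trans hle⟩

end CompleteGraph

theorem mainTheorem1 :
    HeightEq (SimpleGraph.completeGraph (Fin 8)) 10 ∧
    WidthEq (SimpleGraph.completeGraph (Fin 8)) 10 ∧
    AreaEq (SimpleGraph.completeGraph (Fin 8)) 100 ∧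
    PerimeterEq (SimpleGraph.completeGraph (Fin 8)) 40 := by
  refine ⟨⟨⟨_, tenByTen_mem_boundingBoxes, rfl⟩, ?_⟩, ⟨⟨_, tenByTen_mem_boundingBoxes, rfl⟩, ?_⟩,
    ⟨⟨_, tenByTen_mem_boundingBoxes, rfl⟩, ?_⟩, ⟨⟨_, tenByTen_mem_boundingBoxes, rfl⟩, ?_⟩⟩
  all_goals
    rintro _ ⟨B, hB, rfl⟩
    obtain ⟨hh, hw⟩ := ten_le_of_mem_boundingBoxes hB
  · exact hh
  · exact hw
  · unfold IntRect.area
    nlinarith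
  · unfold IntRect.perimeter
    omega
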